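/- **Conventions.** Languages are computable and relational. A computable $\Sigma_1$ formula is a disjunction, over a computably enumerable set, of finitary existential formulas in a fixed finite tuple of free variables. A generalized computable $\Sigma_1$ definition (without parameters) of a relation $R$ on finite tuples from a structure $\mathcal{B}$ is a computable family of computable $\Sigma_1$ formulas, one for each possible choice of lengths of the tuples, each of which defines the part of $R$ on tuples of these lengths. An effective interpretation of $\mathcal{A}=(A,(R_i)_i)$ in $\mathcal{B}$ consists of a set $D\subseteq\mathcal{B}^{<\omega}$, an equivalence relation $\sim$ on $D$ and $\sim$-invariant relations $R_i^*$ on $D$ with $(D,(R_i^*)_i)/{\sim}\cong\mathcal{A}$, such that $D$, $\sim$, $\not\sim$, all $R_i^*$ and all complements $\neg R_i^*$ (within $D$) are defined, without parameters, by a computable sequence of generalized computable $\Sigma_1$ formulas. Write $\mathcal{A}^{\mathcal{B}}$ for the copy of $\mathcal{A}$ obtained from these formulas in $\mathcal{B}$. The structures $\mathcal{A}$ and $\mathcal{B}$ are *effectively bi-interpretable* if there are effective interpretations of $\mathcal{A}$ in $\mathcal{B}$ and of $\mathcal{B}$ in $\mathcal{A}$ and isomorphisms $f:\mathcal{A}\to\mathcal{A}^{\mathcal{B}^{\mathcal{A}}}$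 and $g:\mathcal{B}\to\mathcal{B}^{\mathcal{A}^{\mathcal{B}}}$ such that the relations $R_f$ and $R_g$ have generalized computable $\Sigma_1$ definitions without parameters; here $R_f$ holds of $a,\bar a_1,\dots,\bar a_r$ iff $f(a)$ is the class of the tuple of the classes of $\bar a_1,\dots,\bar a_r$, and $R_g$ is defined in the same way. For a field $F$, regarded as a structure with the graphs of $+$ and $\cdot$, let $H(F)$ be its Heisenberg group, that is, the group of upper triangular $3\times3$ matrices over $F$ with $1$'s on the diagonal, regarded as a structure with the graph of its multiplication. **Theorem.** 1. There is no single system of formulas that, for all countable fields $F$ simultaneously, witnesses that $F$ and $H(F)$ are effectively bi-interpretable; that is, $F$ and $H(F)$ are not uniformly effectively bi-interpretable. 2. $\mathbb{Q}$ and $H(\mathbb{Q})$ are not effectively bi-interpretable. 3. The field $\mathbb{Q}$ is rigid: its only automorphism is the identity. 4. The group $H(\mathbb{Q})$ has a nontrivial automorphism. In fact, for every non-commuting pair $u,v\in H(\mathbb{Q})$ there is an automorphism of $H(\mathbb{Q})$ that takes $u$ to $v$ and $v$ to $u$. 5. If two structures $\mathcal{A}$ and $\mathcal{B}$ for computable relational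 languages are effectively bi-interpretable, then the groups $\mathrm{Aut}(\mathcal{A})$ and $\mathrm{Aut}(\mathcal{B})$ are isomorphic. -/

import Mathlib

open scoped FirstOrder

/-! ### Generalized computable `Σ₁` formulas -/

/-- A computable relational language: the relation symbols are effectively coded by natural
numbers, and the arity of a symbol is computable from its code. -/
class ComputableLanguage (L : FirstOrder.Language.{0, 0}) extends Primcodable (Σ n, L.Relations n) where
  relational : L.IsRelational
  arity_computable : Computable (fun r : (Σ n, L.Relations n) => r.1)

attribute [instance] ComputableLanguage.relational

/-- Code of a term of a relational language; such a term is a variable (free or bound). -/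
def codeTerm {L : FirstOrder.Language.{0, 0}} [ComputableLanguage L] {m k : ℕ} :
    L.Term (Fin m ⊕ Fin k) → ℕ
  | .var x => Encodable.encode x
  | .func f _ => isEmptyElim f

/-- The Gödel number of a finitary formula with free variables `Fin m`
and `k` further variables. -/
def codeFormula {L : FirstOrder.Language.{0, 0}} [ComputableLanguage L] {m : ℕ} :
    ∀ {k : ℕ}, L.BoundedFormula (Fin m) k → ℕ
  | _, .falsum => Nat.pair 0 0
  | _, .equal t₁ t₂ => Nat.pair 1 (Nat.pair (codeTerm t₁) (codeTerm t₂))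
  | _, .rel (l := l) R ts => Nat.pair 2 (Nat.pair
      (Encodable.encode (⟨l, R⟩ : Σ n, L.Relations n))
      (Encodable.encode (List.ofFn fun i => codeTerm (ts i))))
  | _, .imp φ ψ => Nat.pair 3 (Nat.pair (codeFormula φ) (codeFormula ψ))
  | _, .all φ => Nat.pair 4 (codeFormula φ)

/-- A computable sequence, indexed by `J`, of generalized computable `Σ₁` formulas without
parameters, each defining a relation on `B^{<ω}` of finite, possibly varying, arity.

An argument is a finite sequence of tuples `(b̄₁, …, b̄ᵣ)`; its shape is the list `s` of the lengths
of the `b̄ᵢ`. For every index `j` and shape `s` there is a computable `Σ₁` formula in `s.sum` free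
variables, namely the disjunction over `k` and over the `ψ ∈ disj j s k` of `∃ y₁ … y_k, ψ`, with
`ψ` finitary and quantifier-free. Uniform computability: the set of all (codes of) such disjuncts
is computably enumerable. -/
structure SigmaOneFamily (L : FirstOrder.Language.{0, 0}) [ComputableLanguage L]
    (J : Type) [Primcodable J] where
  disj : (j : J) → (s : List ℕ) → (k : ℕ) → Set (L.BoundedFormula (Fin s.sum) k)
  isQF : ∀ j s k, ∀ ψ ∈ disj j s k, ψ.IsQF
  re : REPred fun p : J × List ℕ × ℕ × ℕ =>
    ∃ ψ ∈ disj p.1 p.2.1 p.2.2.1, codeFormula ψ = p.2.2.2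

/-- The concatenation of a finite sequence of tuples, as a valuation of the free variables. -/
def tupleEntries {B : Type} (t : List (List B)) (i : Fin (t.map List.length).sum) : B :=
  t.flatten.get (i.cast List.length_flatten.symm)

/-- The `j`-th formula of the family holds in `B` of the sequence of tuples `t`. -/
def SigmaOneFamily.Holds {L : FirstOrder.Language.{0, 0}} [ComputableLanguage L] {J : Type} [Primcodable J]
    (Φ : SigmaOneFamily L J) {B : Type} [L.Structure B] (j : J) (t : List (List B)) : Prop :=
  ∃ k, ∃ ψ ∈ Φ.disj j (t.map List.length) k, ψ.exs.Realize (tupleEntries t)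

/-! ### Effective interpretations -/

/-- The formulas of an effective interpretation of `L`-structures in `L'`-structures: `L'`-formulas
for the domain `D`, for `∼` (index `true`) and `≁` (index `false`), and for each relation `R*`
(index `(true, R)`) and its complement (index `(false, R)`). -/
structure InterpFormulas (L L' : FirstOrder.Language.{0, 0}) [ComputableLanguage L]
    [ComputableLanguage L'] where
  dom : SigmaOneFamily L' Unit
  eqv : SigmaOneFamily L' Bool
  rel : SigmaOneFamily L' (Bool × (Σ n, L.Relations n))

namespace InterpFormulas

variable {L L' : FirstOrder.Language.{0, 0}} [ComputableLanguage L] [ComputableLanguage L']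

/-- The set `D` of tuples of `B` defined by the domain formula. -/
def Dom (I : InterpFormulas L L') (B : Type) [L'.Structure B] : Type :=
  {b : List B // I.dom.Holds () [b]}

/-- The universe `D/∼` of the structure defined in `B`. -/
def Carrier (I : InterpFormulas L L') (B : Type) [L'.Structure B] : Type :=
  Quot fun b c : I.Dom B => I.eqv.Holds true [b.1, c.1]

/-- The `∼`-class of an element of `D`. -/
def cls (I : InterpFormulas L L') {B : Type} [L'.Structure B] (b : I.Dom B) : I.Carrier B :=
  Quot.mk _ b

/-- The structure `(D, (R*)_R)/∼`. -/
instance (I : InterpFormulas L L') (B : Type) [L'.Structure B] : L.Structure (I.Carrier B) where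
  funMap f := isEmptyElim f
  RelMap {n} R x := ∃ d : Fin n → I.Dom B, (∀ i, I.cls (d i) = x i) ∧
    I.rel.Holds (true, ⟨n, R⟩) (List.ofFn fun i => (d i).1)

/-- In `B`, the formulas define `D`, relations `∼` and `R*` on `D` and their complements on `D`,
where `∼` is an equivalence relation with which all `R*` are compatible. -/
structure WellDefined (I : InterpFormulas L L') (B : Type) [L'.Structure B] : Prop where
  eqv_dom : ∀ (s : Bool) (b c : List B), I.eqv.Holds s [b, c] →
    I.dom.Holds () [b] ∧ I.dom.Holds () [c]
  eqv_equivalence : Equivalence fun b c : I.Dom B => I.eqv.Holds true [b.1, c.1]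
  eqv_compl : ∀ b c : I.Dom B, I.eqv.Holds false [b.1, c.1] ↔ ¬ I.eqv.Holds true [b.1, c.1]
  rel_dom : ∀ (s : Bool) (n : ℕ) (R : L.Relations n) (d : Fin n → List B),
    I.rel.Holds (s, ⟨n, R⟩) (List.ofFn d) → ∀ i, I.dom.Holds () [d i]
  rel_congr : ∀ (n : ℕ) (R : L.Relations n) (d e : Fin n → I.Dom B),
    (∀ i, I.eqv.Holds true [(d i).1, (e i).1]) →
    I.rel.Holds (true, ⟨n, R⟩) (List.ofFn fun i => (d i).1) →
    I.rel.Holds (true, ⟨n, R⟩) (List.ofFn fun i => (e i).1)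
  rel_compl : ∀ (n : ℕ) (R : L.Relations n) (d : Fin n → I.Dom B),
    I.rel.Holds (false, ⟨n, R⟩) (List.ofFn fun i => (d i).1) ↔
      ¬ I.rel.Holds (true, ⟨n, R⟩) (List.ofFn fun i => (d i).1)

/-- The formulas define an effective interpretation of `A` in `B`. -/
def Interprets (I : InterpFormulas L L') (A B : Type) [L.Structure A] [L'.Structure B] : Prop :=
  I.WellDefined B ∧ Nonempty (A ≃[L] I.Carrier B)

/-- The formula `Φ` defines the relation representing the isomorphism `f : A ≅ A^(B^A)`, where
`B^A = J.Carrier A`: it holds of `a, ā₁, …, āᵣ` iff the `āᵢ` represent elements of `B^A`, the tuple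
of these elements represents an element of `A^(B^A)`, and this element is `f a`. -/
def DefinesIso (I : InterpFormulas L L') (J : InterpFormulas L' L) {A : Type} [L.Structure A]
    (Φ : SigmaOneFamily L Unit) (f : A ≃[L] I.Carrier (J.Carrier A)) : Prop :=
  ∀ (a : A) (l : List (List A)), Φ.Holds () ([a] :: l) ↔
    ∃ d : List (J.Dom A), d.map (fun x => x.1) = l ∧
      ∃ h : I.dom.Holds () [d.map J.cls], f a = I.cls ⟨d.map J.cls, h⟩

end InterpFormulas

/-! ### Effective bi-interpretability -/

/-- The formulas `I`, `J`, `Φ`, `Ψ` witness that `A` and `B` are effectively bi-interpretable: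
`I` interprets `A` in `B`, `J` interprets `B` in `A`, and `Φ`, `Ψ` define isomorphisms
`A ≅ A^(B^A)` and `B ≅ B^(A^B)`. -/
def BiInterpretsVia {L L' : FirstOrder.Language.{0, 0}} [ComputableLanguage L] [ComputableLanguage L']
    (I : InterpFormulas L L') (J : InterpFormulas L' L)
    (Φ : SigmaOneFamily L Unit) (Ψ : SigmaOneFamily L' Unit)
    (A B : Type) [L.Structure A] [L'.Structure B] : Prop :=
  I.Interprets A B ∧ J.Interprets B A ∧
    (∃ f : A ≃[L] I.Carrier (J.Carrier A), I.DefinesIso J Φ f) ∧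
    (∃ g : B ≃[L'] J.Carrier (I.Carrier B), J.DefinesIso I Ψ g)

/-- The structures `A` and `B` are effectively bi-interpretable. -/
def EffectivelyBiInterpretable (L L' : FirstOrder.Language.{0, 0}) [ComputableLanguage L]
    [ComputableLanguage L'] (A B : Type) [L.Structure A] [L'.Structure B] : Prop :=
  ∃ (I : InterpFormulas L L') (J : InterpFormulas L' L)
    (Φ : SigmaOneFamily L Unit) (Ψ : SigmaOneFamily L' Unit), BiInterpretsVia I J Φ Ψ A B

/-- The automorphism groups of `A` and `B` are isomorphic. -/
def AutIsomorphic (L L' : FirstOrder.Language.{0, 0}) (A B : Type) [L.Structure A] [L'.Structure B] : Prop :=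
  ∃ e : (A ≃[L] A) ≃ (B ≃[L'] B), ∀ σ τ, e (σ.comp τ) = (e σ).comp (e τ)

/-! ### Fields and groups as relational structures -/

/-- The relation symbols for fields: the graphs of addition and multiplication. -/
inductive FieldRel : ℕ → Type
  | add : FieldRel 3
  | mul : FieldRel 3

/-- The relational language of fields. -/
def fieldLang : FirstOrder.Language.{0, 0} := ⟨fun _ => Empty, FieldRel⟩

/-- The relation symbols for fields are coded by the two booleans. -/
def fieldRelEquiv : (Σ n, fieldLang.Relations n) ≃ Bool where
  toFun r := match r with
    | ⟨_, FieldRel.add⟩ => false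
    | ⟨_, FieldRel.mul⟩ => true
  invFun b := match b with
    | false => ⟨3, FieldRel.add⟩
    | true => ⟨3, FieldRel.mul⟩
  left_inv := by rintro ⟨_, r⟩; cases r <;> rfl
  right_inv := by rintro (_ | _) <;> rfl

instance : ComputableLanguage fieldLang where
  toPrimcodable := Primcodable.ofEquiv Bool fieldRelEquiv
  relational := fun _ => inferInstanceAs (IsEmpty Empty)
  arity_computable := by
    let _ : Primcodable (Σ n, fieldLang.Relations n) := Primcodable.ofEquiv Bool fieldRelEquiv
    refine (Computable.const 3).of_eq ?_
    rintro ⟨_, r⟩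
    cases r <;> rfl

/-- A field as a structure for the relational language of fields. -/
instance (F : Type) [Field F] : fieldLang.Structure F where
  funMap f := isEmptyElim f
  RelMap R x := match R with
    | FieldRel.add => x 0 + x 1 = x 2
    | FieldRel.mul => x 0 * x 1 = x 2

/-- The relation symbol for groups: the graph of multiplication. -/
inductive GroupRel : ℕ → Type
  | mul : GroupRel 3

/-- The relational language of groups. -/
def groupLang : FirstOrder.Language.{0, 0} := ⟨fun _ => Empty, GroupRel⟩

/-- There is exactly one relation symbol for groups. -/
def groupRelEquiv : (Σ n, groupLang.Relations n) ≃ Unit where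
  toFun _ := ()
  invFun _ := ⟨3, GroupRel.mul⟩
  left_inv := by rintro ⟨_, r⟩; cases r; rfl
  right_inv _ := rfl

instance : ComputableLanguage groupLang where
  toPrimcodable := Primcodable.ofEquiv Unit groupRelEquiv
  relational := fun _ => inferInstanceAs (IsEmpty Empty)
  arity_computable := by
    let _ : Primcodable (Σ n, groupLang.Relations n) := Primcodable.ofEquiv Unit groupRelEquiv
    refine (Computable.const 3).of_eq ?_
    rintro ⟨_, r⟩
    cases r
    rfl

/-- A group as a structure for the relational language of groups. -/
instance (G : Type) [Group G] : groupLang.Structure G where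
  funMap f := isEmptyElim f
  RelMap R x := match R with
    | GroupRel.mul => x 0 * x 1 = x 2

/-! ### The Heisenberg group -/

/-- The Heisenberg group `H(F)`: the matrices `!![1, a, c; 0, 1, b; 0, 0, 1]` in `GL₃(F)`. -/
def Heisenberg (F : Type) [Field F] : Subgroup (GL (Fin 3) F) where
  carrier := {g | ∃ a b c : F, (g : Matrix (Fin 3) (Fin 3) F) = !![1, a, c; 0, 1, b; 0, 0, 1]}
  one_mem' := ⟨0, 0, 0, by ext i j; fin_cases i <;> fin_cases j <;> simp⟩
  mul_mem' := by
    rintro g g' ⟨a, b, c, h⟩ ⟨a', b', c', h'⟩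
    refine ⟨a + a', b + b', c + c' + a * b', ?_⟩
    rw [Units.val_mul, h, h']
    ext i j
    fin_cases i <;> fin_cases j <;> simp [Matrix.mul_apply, Fin.sum_univ_three] <;> ring
  inv_mem' := by
    rintro g ⟨a, b, c, h⟩
    refine ⟨-a, -b, a * b - c, ?_⟩
    refine Units.inv_eq_of_mul_eq_one_right ?_
    rw [h]
    ext i j
    fin_cases i <;> fin_cases j <;> simp [Matrix.mul_apply, Fin.sum_univ_three]
    ring

/-- There is one system of formulas witnessing, for all countable fields `F` simultaneously, that
`F` and `H(F)` are effectively bi-interpretable. -/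
def UniformlyEffectivelyBiInterpretableHeisenberg : Prop :=
  ∃ (I : InterpFormulas fieldLang groupLang) (J : InterpFormulas groupLang fieldLang)
    (Φ : SigmaOneFamily fieldLang Unit) (Ψ : SigmaOneFamily groupLang Unit),
    ∀ (F : Type) [Field F] [Countable F], BiInterpretsVia I J Φ Ψ F (Heisenberg F)

/-! Parameter-free definitions are preserved by isomorphisms (`SigmaOneFamily.Holds.map`), so an
interpretation acts functorially on isomorphisms (`InterpFormulas.map`). In a bi-interpretation this
gives homomorphisms between the automorphism groups in both directions. Since the graph of `f : A ≅
A^(B^A)` is definable, `f` commutes with automorphisms (`DefinesIso.apply_automorphism`), so each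
round trip is conjugation by a fixed automorphism, hence bijective. The automorphism groups are
therefore isomorphic.

For `ℚ` this fails: the field is rigid, while `exists_mulEquiv_swap` moves elements of `H(ℚ)`. A
uniform bi-interpretation would apply in particular to `ℚ`. -/

open FirstOrder.Language

/-! ### Invariance of generalized `Σ₁` definitions under isomorphisms -/

namespace SigmaOneFamily

variable {L : FirstOrder.Language.{0, 0}} [ComputableLanguage L] {J : Type} [Primcodable J]
  {B C : Type} [L.Structure B] [L.Structure C]

/-- Shapes of a tuple and of its image agree only propositionally, so the two valuations have
different index types. Keeping the shapes as variables lets `subst` identify them. -/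
theorem exists_realize_of_equiv (Φ : SigmaOneFamily L J) (e : B ≃[L] C) (j : J) {s s' : List ℕ}
    (h : s' = s) (v : Fin s.sum → B) (w : Fin s'.sum → C)
    (hw : ∀ i, w i = e (v (i.cast (congrArg List.sum h))))
    (hv : ∃ k, ∃ ψ ∈ Φ.disj j s k, ψ.exs.Realize v) :
    ∃ k, ∃ ψ ∈ Φ.disj j s' k, ψ.exs.Realize w := by
  subst h
  obtain ⟨k, ψ, hψ, hr⟩ := hv
  refine ⟨k, ψ, hψ, ?_⟩
  have hwv : w = e ∘ v := funext hw
  rw [hwv]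
  exact (StrongHomClass.realize_formula e ψ.exs).2 hr

theorem Holds.map {Φ : SigmaOneFamily L J} {j : J} {t : List (List B)} (h : Φ.Holds j t)
    (e : B ≃[L] C) : Φ.Holds j (t.map (List.map e)) := by
  refine exists_realize_of_equiv Φ e j (by simp) (tupleEntries t) _ (fun i => ?_) h
  simp [tupleEntries, ← List.map_flatten]

end SigmaOneFamily

/-! ### Functoriality of effective interpretations -/

namespace InterpFormulas

variable {L L' : FirstOrder.Language.{0, 0}} [ComputableLanguage L] [ComputableLanguage L']
  {B C D : Type} [L'.Structure B] [L'.Structure C] [L'.Structure D]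

/-- The action of an isomorphism on the domain of an interpretation. -/
def mapDom (I : InterpFormulas L L') (e : B ≃[L'] C) (b : I.Dom B) : I.Dom C :=
  ⟨b.1.map e, b.2.map e⟩

/-- The action of an isomorphism on the universe of the interpreted structure. -/
def mapFun (I : InterpFormulas L L') (e : B ≃[L'] C) : I.Carrier B → I.Carrier C :=
  Quot.map (I.mapDom e) fun _ _ h => h.map e

theorem mapFun_cls (I : InterpFormulas L L') (e : B ≃[L'] C) (b : I.Dom B) :
    I.mapFun e (I.cls b) = I.cls (I.mapDom e b) := rfl

theorem mapFun_refl (I : InterpFormulas L L') (x : I.Carrier B) :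
    I.mapFun (FirstOrder.Language.Equiv.refl L' B) x = x := by
  induction x using Quot.ind with
  | mk b => exact congrArg I.cls (Subtype.ext (List.map_id b.1))

theorem mapFun_comp (I : InterpFormulas L L') (e : C ≃[L'] D) (e' : B ≃[L'] C)
    (x : I.Carrier B) : I.mapFun (e.comp e') x = I.mapFun e (I.mapFun e' x) := by
  induction x using Quot.ind with
  | mk b => exact congrArg I.cls (Subtype.ext (by simp [mapDom]))

theorem relMap_mapFun (I : InterpFormulas L L') (e : B ≃[L'] C) {n : ℕ} (R : L.Relations n)
    (x : Fin n → I.Carrier B) (h : Structure.RelMap R x) :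
    Structure.RelMap R (I.mapFun e ∘ x) := by
  obtain ⟨d, hd, hR⟩ := h
  refine ⟨fun i => I.mapDom e (d i), fun i => ?_, ?_⟩
  · rw [← mapFun_cls, hd i]; rfl
  · have := hR.map e
    rw [List.map_ofFn] at this
    exact this

theorem mapFun_symm_mapFun (I : InterpFormulas L L') (e : B ≃[L'] C) (x : I.Carrier B) :
    I.mapFun e.symm (I.mapFun e x) = x := by
  rw [← mapFun_comp, show e.symm.comp e = .refl L' B from FirstOrder.Language.Equiv.ext e.symm_apply_apply, mapFun_refl]

theorem mapFun_mapFun_symm (I : InterpFormulas L L') (e : B ≃[L'] C) (x : I.Carrier C) :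
    I.mapFun e (I.mapFun e.symm x) = x := by
  rw [← mapFun_comp, show e.comp e.symm = .refl L' C from FirstOrder.Language.Equiv.ext e.apply_symm_apply, mapFun_refl]

/-- An isomorphism of structures induces an isomorphism of the interpreted structures. -/
def map (I : InterpFormulas L L') (e : B ≃[L'] C) : I.Carrier B ≃[L] I.Carrier C where
  toFun := I.mapFun e
  invFun := I.mapFun e.symm
  left_inv := I.mapFun_symm_mapFun e
  right_inv := I.mapFun_mapFun_symm e
  map_fun' f := isEmptyElim f
  map_rel' R x := by
    refine ⟨fun h => ?_, I.relMap_mapFun e R x⟩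
    have := I.relMap_mapFun e.symm R _ h
    simpa [Function.comp_def, mapFun_symm_mapFun] using this

theorem map_comp (I : InterpFormulas L L') (e : C ≃[L'] D) (e' : B ≃[L'] C) :
    I.map (e.comp e') = (I.map e).comp (I.map e') :=
  FirstOrder.Language.Equiv.ext fun x => I.mapFun_comp e e' x

/-- An isomorphism `A ≅ A^(B^A)` with a parameter-free definition commutes with automorphisms. -/
theorem DefinesIso.apply_automorphism {I : InterpFormulas L L'} {J : InterpFormulas L' L}
    {A : Type} [L.Structure A] {Φ : SigmaOneFamily L Unit} {f : A ≃[L] I.Carrier (J.Carrier A)}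
    (hf : I.DefinesIso J Φ f) (σ : A ≃[L] A) (a : A) : f (σ a) = I.map (J.map σ) (f a) := by
  obtain ⟨⟨x, hx⟩, hfa⟩ : ∃ x, I.cls x = f a := Quot.exists_rep _
  obtain ⟨d, rfl⟩ : ∃ d : List (J.Dom A), d.map J.cls = x :=
    List.map_surjective_iff.2 (Quot.exists_rep ·) x
  -- The pair consisting of `a` and representatives of `f a` lies in the defined graph; `σ` moves it
  -- to another pair in the graph.
  have h := ((hf a (d.map fun y => y.1)).2 ⟨d, rfl, hx, hfa.symm⟩).map σ
  obtain ⟨d', hd', h', hfσ⟩ := (hf (σ a) ((d.map fun y : J.Dom A => y.1).map (List.map σ))).1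
    (by simpa only [List.map_cons, List.map_nil] using h)
  obtain rfl : d' = d.map (J.mapDom σ) := by
    apply List.map_injective_iff.2 (fun _ _ => Subtype.ext :
      Function.Injective fun y : J.Dom A => y.1)
    rw [hd']
    change _ = (d.map (J.mapDom σ)).map fun y : J.Dom A => y.1
    rw [List.map_map, List.map_map]
    rfl
  refine hfσ.trans (Eq.trans ?_ (congrArg (I.mapFun (J.map σ)) hfa))
  refine congrArg I.cls (Subtype.ext ?_)
  change _ = (d.map J.cls).map (J.map σ)
  simp only [List.map_map]
  rfl

end InterpFormulas

/-! ### Automorphism groups of bi-interpretable structures -/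

section Automorphisms

variable {L L' : FirstOrder.Language.{0, 0}} [ComputableLanguage L] [ComputableLanguage L']
  {A B : Type} [L.Structure A] [L'.Structure B]

/-- The automorphism of `B` that an automorphism of `A` induces when `B` is interpreted in `A`. -/
def inducedAut (J : InterpFormulas L' L) (β : B ≃[L'] J.Carrier A) (σ : A ≃[L] A) : B ≃[L'] B :=
  β.symm.comp ((J.map σ).comp β)

theorem inducedAut_comp (J : InterpFormulas L' L) (β : B ≃[L'] J.Carrier A) (σ τ : A ≃[L] A) :
    inducedAut J β (σ.comp τ) = (inducedAut J β σ).comp (inducedAut J β τ) := by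
  ext b
  simp [inducedAut, InterpFormulas.map_comp]

/-- Going to `B` and back is conjugation by an automorphism of `A`. -/
theorem inducedAut_inducedAut {I : InterpFormulas L L'} {J : InterpFormulas L' L}
    {Φ : SigmaOneFamily L Unit} {f : A ≃[L] I.Carrier (J.Carrier A)} (hf : I.DefinesIso J Φ f)
    (α : A ≃[L] I.Carrier B) (β : B ≃[L'] J.Carrier A) (σ : A ≃[L] A) :
    let c : A ≃[L] A := f.symm.comp ((I.map β).comp α)
    inducedAut I α (inducedAut J β σ) = c.symm.comp (σ.comp c) := by
  intro c
  -- `c` compares `f` with the isomorphism onto `A^(B^A)` composed from `α` and `β`, which were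
  -- chosen independently of `f`.
  have hc (a : A) : f (c a) = I.map β (α a) := by simp [c]
  ext a
  apply c.injective
  apply f.injective
  have hR : c ((c.symm.comp (σ.comp c)) a) = σ (c a) := c.apply_symm_apply _
  rw [hR, hf.apply_automorphism σ, hc, hc]
  simp only [inducedAut, FirstOrder.Language.Equiv.comp_apply,
    FirstOrder.Language.Equiv.apply_symm_apply, InterpFormulas.map_comp]
  exact I.mapFun_mapFun_symm β _

theorem inducedAut_inducedAut_bijective {I : InterpFormulas L L'} {J : InterpFormulas L' L}
    {Φ : SigmaOneFamily L Unit} {f : A ≃[L] I.Carrier (J.Carrier A)} (hf : I.DefinesIso J Φ f)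
    (α : A ≃[L] I.Carrier B) (β : B ≃[L'] J.Carrier A) :
    Function.Bijective (inducedAut I α ∘ inducedAut J β) := by
  set c : A ≃[L] A := f.symm.comp ((I.map β).comp α)
  have h (σ : A ≃[L] A) : (inducedAut I α ∘ inducedAut J β) σ = c.symm.comp (σ.comp c) :=
    inducedAut_inducedAut hf α β σ
  constructor
  · intro σ τ hστ
    rw [h, h] at hστ
    ext a
    have := DFunLike.congr_fun hστ (c.symm a)
    simpa using this
  · intro τ
    refine ⟨c.comp (τ.comp c.symm), ?_⟩
    rw [h]
    ext a
    simp

/-- The two round trips, one on each side, make the same map `inducedAut J β` injective and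
surjective; it need not be inverse to `inducedAut I α`. -/
theorem EffectivelyBiInterpretable.autIsomorphic
    (h : EffectivelyBiInterpretable L L' A B) : AutIsomorphic L L' A B := by
  obtain ⟨I, J, Φ, Ψ, ⟨-, ⟨α⟩⟩, ⟨-, ⟨β⟩⟩, ⟨f, hf⟩, ⟨g, hg⟩⟩ := h
  have hinj : Function.Injective (inducedAut J β) :=
    (inducedAut_inducedAut_bijective hf α β).1.of_comp
  have hsurj : Function.Surjective (inducedAut J β) :=
    (inducedAut_inducedAut_bijective hg β α).2.of_comp
  exact ⟨_root_.Equiv.ofBijective _ ⟨hinj, hsurj⟩, inducedAut_comp J β⟩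

end Automorphisms

/-! ### Automorphisms of fields and groups as structures -/

/-- An automorphism of the relational structure of a field is a ring automorphism. -/
def fieldAutToRingEquiv {F : Type} [Field F] (σ : F ≃[fieldLang] F) : F ≃+* F where
  toEquiv := σ.toEquiv
  map_add' x y := ((σ.map_rel (FieldRel.add : fieldLang.Relations 3) ![x, y, x + y]).2 rfl).symm
  map_mul' x y := ((σ.map_rel (FieldRel.mul : fieldLang.Relations 3) ![x, y, x * y]).2 rfl).symm

/-- A group automorphism is an automorphism of the relational structure. -/
def groupAutOfMulEquiv {G : Type} [Group G] (σ : G ≃* G) : G ≃[groupLang] G where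
  toEquiv := σ.toEquiv
  map_fun' f := isEmptyElim f
  map_rel' R x := by
    cases R
    change σ (x 0) * σ (x 1) = σ (x 2) ↔ x 0 * x 1 = x 2
    rw [← map_mul, σ.injective.eq_iff]

/-! ### The Heisenberg group in coordinates -/

namespace Heisenberg

variable {F : Type} [Field F]

/-- The matrix with given coordinates as an element of `H(F)`. -/
def mk (a b c : F) : Heisenberg F :=
  ⟨⟨!![1, a, c; 0, 1, b; 0, 0, 1], !![1, -a, a * b - c; 0, 1, -b; 0, 0, 1],
    by ext i j; fin_cases i <;> fin_cases j <;> simp [Matrix.mul_apply, Fin.sum_univ_three]; ring,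
    by ext i j; fin_cases i <;> fin_cases j <;> simp [Matrix.mul_apply, Fin.sum_univ_three]; ring⟩, a, b, c, rfl⟩

theorem exists_mk (g : Heisenberg F) : ∃ a b c, g = mk a b c := by
  obtain ⟨g, a, b, c, h⟩ := g
  exact ⟨a, b, c, Subtype.ext (Units.ext h)⟩

theorem mk_mul_mk (a b c a' b' c' : F) :
    mk a b c * mk a' b' c' = mk (a + a') (b + b') (c + c' + a * b') := by
  refine Subtype.ext (Units.ext ?_)
  change !![1, a, c; 0, 1, b; 0, 0, 1] * !![1, a', c'; 0, 1, b'; 0, 0, 1] = _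
  ext i j
  fin_cases i <;> fin_cases j <;> simp [mk, Matrix.mul_apply, Fin.sum_univ_three] <;> ring

theorem mk_inj {a b c a' b' c' : F} : mk a b c = mk a' b' c' ↔ a = a' ∧ b = b' ∧ c = c' := by
  refine ⟨fun h => ?_, by rintro ⟨rfl, rfl, rfl⟩; rfl⟩
  have h (i j : Fin 3) := congrFun₂ (congrArg (fun g : Heisenberg F =>
    ((g : GL (Fin 3) F) : Matrix (Fin 3) (Fin 3) F)) h) i j
  exact ⟨by simpa [mk] using h 0 1, by simpa [mk] using h 1 2, by simpa [mk] using h 0 2⟩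

/-- The commutator is central with third coordinate `a * b' - a' * b`, so two elements commute
exactly when their images in `F²` are linearly dependent. -/
theorem mk_mul_comm_iff {a b c a' b' c' : F} :
    mk a b c * mk a' b' c' = mk a' b' c' * mk a b c ↔ a * b' = a' * b := by
  rw [mk_mul_mk, mk_mul_mk, mk_inj]
  constructor
  · rintro ⟨-, -, h⟩
    linear_combination h
  · intro h
    exact ⟨add_comm _ _, add_comm _ _, by linear_combination h⟩

/-- `H(F)` is parametrized by three coordinates. -/
noncomputable def coords : F × F × F ≃ Heisenberg F :=
  Equiv.ofBijective (fun p => mk p.1 p.2.1 p.2.2)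
    ⟨fun p q h => by
      obtain ⟨h₁, h₂, h₃⟩ := mk_inj.1 h
      exact Prod.ext h₁ (Prod.ext h₂ h₃),
    fun g => by
      obtain ⟨a, b, c, rfl⟩ := exists_mk g
      exact ⟨(a, b, c), rfl⟩⟩

theorem coords_symm_mk (a b c : F) : coords.symm (mk a b c) = (a, b, c) :=
  coords.symm_apply_apply (a, b, c)

/-- An involution of the underlying set of `H(F)`: it acts on the first two coordinates by the matrix
`!![p, q; r, -p]` of determinant `-1`. -/
def involution (p q r l m : F) (x : F × F × F) : F × F × F :=
  (p * x.1 + q * x.2.1, r * x.1 - p * x.2.1,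
    -- With `z = c - a * b / 2` the product adds the `z`'s and half the determinant of the
    -- `F²`-parts. A matrix of determinant `-1` negates that term, so `z` goes to `-z`, up to a
    -- linear form with coefficients `l`, `m`.
    -(x.2.2 - x.1 * x.2.1 / 2) + (p * x.1 + q * x.2.1) * (r * x.1 - p * x.2.1) / 2
      + l * x.1 + m * x.2.1)

/-- A trace-zero matrix of determinant `-1` squares to the identity. On `z` the linear form cancels
on the second application because `hl` and `hm` say that it is invariant under the matrix. -/
theorem involution_involutive {p q r l m : F} (hdet : p * p + q * r = 1)
    (hl : l * p + m * r = l) (hm : l * q - m * p = m) :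
    Function.Involutive (involution p q r l m) := by
  rintro ⟨a, b, c⟩
  have ha : p * (p * a + q * b) + q * (r * a - p * b) = a := by linear_combination a * hdet
  have hb : r * (p * a + q * b) - p * (r * a - p * b) = b := by linear_combination b * hdet
  simp only [involution, ha, hb, Prod.mk.injEq, true_and]
  linear_combination a * hl + b * hm

/-- The automorphism of `H(F)` given by `involution`. -/
noncomputable def involutionAut [NeZero (2 : F)] {p q r l m : F} (hdet : p * p + q * r = 1)
    (hl : l * p + m * r = l) (hm : l * q - m * p = m) : Heisenberg F ≃* Heisenberg F where
  toEquiv := coords.symm.trans ((involution_involutive hdet hl hm).toPerm.trans coords)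
  map_mul' g h := by
    obtain ⟨a, b, c, rfl⟩ := exists_mk g
    obtain ⟨a', b', c', rfl⟩ := exists_mk h
    have h2 : (2 : F) ≠ 0 := two_ne_zero
    rw [mk_mul_mk]
    simp only [Equiv.toFun_as_coe, Equiv.trans_apply, coords_symm_mk]
    change mk _ _ _ = mk _ _ _ * mk _ _ _
    rw [mk_mul_mk, mk_inj]
    refine ⟨by simp [involution]; ring, by simp [involution]; ring, ?_⟩
    simp only [Function.Involutive.coe_toPerm, involution]
    field_simp
    linear_combination (a * b' - a' * b) * hdet

theorem involutionAut_mk [NeZero (2 : F)] {p q r l m : F} (hdet : p * p + q * r = 1)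
    (hl : l * p + m * r = l) (hm : l * q - m * p = m) (a b c : F) :
    involutionAut hdet hl hm (mk a b c) = mk (p * a + q * b) (r * a - p * b)
      (-(c - a * b / 2) + (p * a + q * b) * (r * a - p * b) / 2 + l * a + m * b) := by
  change coords (involution p q r l m (coords.symm (mk a b c))) = _
  rw [coords_symm_mk]
  rfl

/-- Every non-commuting pair in `H(F)` is swapped by an automorphism. -/
theorem exists_mulEquiv_swap [NeZero (2 : F)] {u v : Heisenberg F} (h : u * v ≠ v * u) :
    ∃ σ : Heisenberg F ≃* Heisenberg F, σ u = v ∧ σ v = u := by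
  obtain ⟨a, b, c, rfl⟩ := exists_mk u
  obtain ⟨a', b', c', rfl⟩ := exists_mk v
  rw [Ne, mk_mul_comm_iff, ← sub_eq_zero] at h
  obtain ⟨d, hd⟩ : ∃ d, (a * b' - a' * b) * d = 1 := ⟨_, mul_inv_cancel₀ h⟩
  -- `T` is the sum of the `z`-coordinates of `u` and `v`: sending `z` to `-z + T` swaps them.
  obtain ⟨T, hT⟩ : ∃ T, T = c - a * b / 2 + (c' - a' * b' / 2) := ⟨_, rfl⟩
  have ha : (a' * b' - a * b) * d * a + (a ^ 2 - a' ^ 2) * d * b = a' := by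
    linear_combination a' * hd
  have hb : (b' ^ 2 - b ^ 2) * d * a - (a' * b' - a * b) * d * b = b' := by
    linear_combination b' * hd
  have ha' : (a' * b' - a * b) * d * a' + (a ^ 2 - a' ^ 2) * d * b' = a := by
    linear_combination a * hd
  have hb' : (b' ^ 2 - b ^ 2) * d * a' - (a' * b' - a * b) * d * b' = b := by
    linear_combination b * hd
  -- The matrix is the one swapping the basis `(a, b)`, `(a', b')`, solved by Cramer's rule; `l`,
  -- `m` give the linear form with value `T` on both basis vectors.
  refine ⟨involutionAut (p := (a' * b' - a * b) * d) (q := (a ^ 2 - a' ^ 2) * d)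
    (r := (b' ^ 2 - b ^ 2) * d) (l := T * (b' - b) * d) (m := T * (a - a') * d) ?_ ?_ ?_, ?_, ?_⟩
  · linear_combination ((a * b' - a' * b) * d + 1) * hd
  · linear_combination T * (b' - b) * d * hd
  · linear_combination T * (a - a') * d * hd
  · rw [involutionAut_mk, ha, hb, mk_inj]
    refine ⟨rfl, rfl, ?_⟩
    linear_combination T * hd + hT
  · rw [involutionAut_mk, ha', hb', mk_inj]
    refine ⟨rfl, rfl, ?_⟩
    linear_combination T * hd + hT

theorem exists_mulEquiv_ne_refl [NeZero (2 : F)] :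
    ∃ σ : Heisenberg F ≃* Heisenberg F, σ ≠ MulEquiv.refl (Heisenberg F) := by
  have hne : mk (1 : F) 0 0 * mk 0 1 0 ≠ mk 0 1 0 * mk 1 0 0 := by
    rw [Ne, mk_mul_comm_iff]
    simp
  obtain ⟨σ, hσ, -⟩ := exists_mulEquiv_swap hne
  refine ⟨σ, ?_⟩
  rintro rfl
  exact one_ne_zero (mk_inj.1 hσ).1

end Heisenberg

theorem not_effectivelyBiInterpretable_rat_heisenberg :
    ¬ EffectivelyBiInterpretable fieldLang groupLang ℚ (Heisenberg ℚ) := by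
  intro h
  obtain ⟨e, -⟩ := h.autIsomorphic
  obtain ⟨σ, hσ⟩ := Heisenberg.exists_mulEquiv_ne_refl (F := ℚ)
  have hsub : Subsingleton (ℚ ≃[fieldLang] ℚ) := ⟨fun σ τ => by
    ext x
    exact DFunLike.congr_fun
      (Subsingleton.elim (fieldAutToRingEquiv σ).toRingHom (fieldAutToRingEquiv τ).toRingHom) x⟩
  -- Only the bijection is needed: rigidity of `ℚ` leaves room for one automorphism of `H(ℚ)`.
  have := e.symm.subsingleton
  refine hσ (MulEquiv.ext fun g => ?_)
  exact DFunLike.congr_fun (Subsingleton.elim (groupAutOfMulEquiv σ)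
    (groupAutOfMulEquiv (MulEquiv.refl _))) g

theorem mainTheorem9 :
    ¬ UniformlyEffectivelyBiInterpretableHeisenberg ∧
    ¬ EffectivelyBiInterpretable fieldLang groupLang ℚ (Heisenberg ℚ) ∧
    (∀ σ : ℚ ≃+* ℚ, σ = RingEquiv.refl ℚ) ∧
    (∃ σ : Heisenberg ℚ ≃* Heisenberg ℚ, σ ≠ MulEquiv.refl (Heisenberg ℚ)) ∧
    (∀ u v : Heisenberg ℚ, u * v ≠ v * u →
      ∃ σ : Heisenberg ℚ ≃* Heisenberg ℚ, σ u = v ∧ σ v = u) ∧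
    (∀ (L L' : FirstOrder.Language.{0, 0}) [ComputableLanguage L] [ComputableLanguage L']
      (A B : Type) [L.Structure A] [L'.Structure B],
      EffectivelyBiInterpretable L L' A B → AutIsomorphic L L' A B) := by
  refine ⟨?_, not_effectivelyBiInterpretable_rat_heisenberg, fun σ => ?_,
    Heisenberg.exists_mulEquiv_ne_refl, fun u v => Heisenberg.exists_mulEquiv_swap,
    fun L L' _ _ A B _ _ h => h.autIsomorphic⟩
  · rintro ⟨I, J, Φ, Ψ, h⟩
    exact not_effectivelyBiInterpretable_rat_heisenberg ⟨I, J, Φ, Ψ, h ℚ⟩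
  · ext x
    exact DFunLike.congr_fun (Subsingleton.elim σ.toRingHom (RingHom.id ℚ)) x
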